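/- Let $M=T\times X\times U$ with $T\subseteq\mathbb R$ an open interval and $X\subseteq\mathbb R^n$, $U\subseteq\mathbb R^m$ open, and let $\dot x=f(t,x,u)$ be a smooth control system on $M$, with Pfaffian system $\omega=\mathrm{span}\{dx^i-f^i\,dt: 1\le i\le n\}$. A trajectory is a smooth curve $s(t)=(t,x(t),u(t))$ in $M$ with $s^*\omega=0$. Let $\nu=\langle\rho_1,\dots,\rho_k\rangle$ be a signature, i.e. a list of non-negative integers. Let $J^\nu$ be the jet space with coordinates $t$ and $z^a_l$ ($0\le l\le r_a$), where $a$ runs over $\sum_j\rho_j$ indices, exactly $\rho_j$ of which have order $r_a=j\geq 1$. Let $\beta^\nu=\mathrm{span}\{dz^a_l-z^a_{l+1}dt: 0\le l<r_a\}$ be its contact system, so that $N_\nu:=\dim J^\nu=1+\sum_j(1+j)\rho_j$. For functions $h=(h^a)$ of $t$ write $j^\nu h(t)=(t,(h^a)^{(l)}(t))_{0\le l\le r_a}$. An explicit solution of signature $\nu$ is a smooth map $\psi:D\to M$ on a nonempty open set $D\subseteq J^\nu$ such that: the number $\sum_j\rho_j$ of arbitrary functions is $m$; for each $a$, $\partial\psi/\partial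 z^a_{r_a}$ is not identically zero on $D$; for all smooth $h$ on an open set of times with $j^\nu h$ in $D$, $s=\psi\circ j^\nu h$ is a trajectory; and all generic trajectories are locally of this form. The last condition means that, for some $K\ge0$ and some open set $G$ of jets $(t,x,u,u',\dots,u^{(K)})$ that is dense over $M$, $\psi|_D$ describes $G$. Here, for an open $V\subseteq D$ and a set $W$ of such jets, we say that $\psi|_V$ describes $W$ if every trajectory whose jet at a time $t_0$ lies in $W$ equals, near $t_0$, $\psi\circ j^\nu h$ for some smooth $h$ with $j^\nu h$ in $V$. Proposition. Let $\psi:D\to M$ be an explicit solution of signature $\nu$ of $(M,\omega)$, and suppose that $\dim M=N_\nu$ and $\mathrm{rank}\,\omega=\mathrm{rank}\,\beta^\nu$. Let $D_0\subseteq D$ be the set of points at which $\psi$ is a smooth local diffeomorphism. Then, away from singularities, $\psi$ is a local diffeomorphism, in the following sense: $D_0$ is open and nonempty, $\psi(D_0)$ is dense in $M$, and $\psi|_{D_0}$ is still an explicit solution of signature $\nu$. More precisely, $D_0$ meets every open $V\subseteq D$ such that, for some $K\geq 0$, $\psi|_V$ describes some open set $W$ of jets $(t,x,u,u',\dots,u^{(K)})$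 that contains a jet over a point of $M$. On $D_0$ one has $\psi^*\omega=\beta^\nu$. Furthermore, $\psi|_{D_0}$ is locally a static feedback transformation: every point of $D_0$ has an open neighbourhood $V\subseteq D_0$ which $\psi$ maps diffeomorphically onto an open subset of $M$ and on which $\psi(t,y,w)=(t,\theta(t,y),\chi(t,y,w))$ with $\theta,\chi$ smooth, where $y=(z^a_l)_{l<r_a}$ and $w=(z^a_{r_a})_a$. -/

import Mathlib

open Set
open scoped ContDiff Manifold

noncomputable section

/-! ### Codistributions and integral curves -/

/-- A codistribution (Pfaffian system) on a vector space: a space of covectors at each point. -/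
abbrev Codistribution (E : Type*) [NormedAddCommGroup E] [NormedSpace ℝ E] :=
  E → Submodule ℝ (E →L[ℝ] ℝ)

/-- The pullback `φ^* Ω`: at `z` it consists of the covectors `ξ ∘ Dφ(z)` with `ξ ∈ Ω (φ z)`. -/
def Codistribution.pullback {E F : Type*} [NormedAddCommGroup E] [NormedSpace ℝ E]
    [NormedAddCommGroup F] [NormedSpace ℝ F] (φ : E → F) (Ω : Codistribution F) :
    Codistribution E :=
  fun z => (Ω (φ z)).map (((ContinuousLinearMap.compL ℝ E F ℝ).flip (fderiv ℝ φ z)) :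
    (F →L[ℝ] ℝ) →ₗ[ℝ] (E →L[ℝ] ℝ))

/-! ### Control systems -/

/-- Time, states and inputs `(t, x, u)`. -/
abbrev ControlSpace (n m : ℕ) := ℝ × (Fin n → ℝ) × (Fin m → ℝ)

/-- A smooth control system `x' = f (t, x, u)` with `t` in an open interval and `x`, `u` in open
sets. -/
structure ControlSystem (n m : ℕ) where
  time : Set ℝ
  states : Set (Fin n → ℝ)
  inputs : Set (Fin m → ℝ)
  isOpen_time : IsOpen time
  isConnected_time : IsConnected time
  isOpen_states : IsOpen states
  isOpen_inputs : IsOpen inputs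
  rhs : ControlSpace n m → Fin n → ℝ
  contDiffOn_rhs : ContDiffOn ℝ ∞ rhs (time ×ˢ states ×ˢ inputs)

namespace ControlSystem

variable {n m : ℕ}

/-- The manifold `M = T × X × U` of the control system. -/
def carrier (S : ControlSystem n m) : Set (ControlSpace n m) :=
  S.time ×ˢ S.states ×ˢ S.inputs

/-- The `1`-form `dx^i - f^i dt` at the point `p`. -/
def form (S : ControlSystem n m) (p : ControlSpace n m) (i : Fin n) :
    ControlSpace n m →L[ℝ] ℝ :=
  (ContinuousLinearMap.proj (R := ℝ) (φ := fun _ : Fin n => ℝ) i).comp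
      ((ContinuousLinearMap.fst ℝ (Fin n → ℝ) (Fin m → ℝ)).comp
        (ContinuousLinearMap.snd ℝ ℝ ((Fin n → ℝ) × (Fin m → ℝ))))
    - S.rhs p i • ContinuousLinearMap.fst ℝ ℝ ((Fin n → ℝ) × (Fin m → ℝ))

/-- The Pfaffian system `ω = span {dx^i - f^i dt}`. -/
def codistribution (S : ControlSystem n m) : Codistribution (ControlSpace n m) :=
  fun p => Submodule.span ℝ (Set.range (S.form p))

/-- `s` is a smooth solution of the control system on `I`, parametrized by time: a smooth curve in
`M` of the form `t ↦ (t, x t, u t)` with `s^* ω = 0`. -/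
structure IsTrajectoryOn (S : ControlSystem n m) (s : ℝ → ControlSpace n m) (I : Set ℝ) :
    Prop where
  contDiffOn : ContDiffOn ℝ ∞ s I
  mapsTo : MapsTo s I S.carrier
  time_eq : ∀ t ∈ I, (s t).1 = t
  annihilates : ∀ t ∈ I, ∀ ξ ∈ S.codistribution (s t), ξ (deriv s t) = 0

end ControlSystem

/-- The space of `(t, x, u, u', …, u^(K))`: it parametrizes the jets of trajectories, since
the derivatives of `x` are determined by the control system. -/
abbrev TrajectoryJetSpace (n m K : ℕ) := ControlSpace n m × (Fin K → Fin m → ℝ)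

/-- `(t, x(t), u(t), u'(t), …, u^(K)(t))` for a curve `s = (t, x, u)`. -/
def trajectoryJet {n m : ℕ} (K : ℕ) (s : ℝ → ControlSpace n m) (t : ℝ) :
    TrajectoryJetSpace n m K :=
  (s t, fun l a => iteratedDeriv ((l : ℕ) + 1) (fun τ => (s τ).2.2 a) t)

/-- The set of trajectory jets lying over `M`. -/
def ControlSystem.jetsOver {n m : ℕ} (S : ControlSystem n m) (K : ℕ) :
    Set (TrajectoryJetSpace n m K) :=
  {p | p.1 ∈ S.carrier}

/-! ### The jet space of a signature and its contact system -/

/-- A signature `⟨ρ_1, …, ρ_k⟩` is a function `ρ : Fin k → ℕ`, where `ρ i` is the number of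
functions of order `i + 1`. This type indexes the `ρ_1 + ⋯ + ρ_k` functions. -/
abbrev SigIndex {k : ℕ} (ρ : Fin k → ℕ) := Σ i : Fin k, Fin (ρ i)

/-- The order of the function with index `a`. -/
def SigIndex.order {k : ℕ} {ρ : Fin k → ℕ} (a : SigIndex ρ) : ℕ := (a.1 : ℕ) + 1

/-- Indices `(a, l)`, `0 ≤ l ≤ r_a`, of the jet coordinates `z^a_l`. -/
abbrev JetIndex {k : ℕ} (ρ : Fin k → ℕ) := Σ a : SigIndex ρ, Fin (a.order + 1)

/-- Indices `(a, l)`, `0 ≤ l < r_a`, of the jet coordinates of non-maximal order. -/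
abbrev LowerJetIndex {k : ℕ} (ρ : Fin k → ℕ) := Σ a : SigIndex ρ, Fin a.order

/-- The partially prolonged jet space `J^ν`, with coordinates `t` and `z^a_l`, `0 ≤ l ≤ r_a`. -/
abbrev JetSpace {k : ℕ} (ρ : Fin k → ℕ) := ℝ × (JetIndex ρ → ℝ)

/-- The coordinates of non-maximal order (the states of the Brunovsky normal form). -/
def JetSpace.lower {k : ℕ} {ρ : Fin k → ℕ} (z : JetSpace ρ) : LowerJetIndex ρ → ℝ :=
  fun c => z.2 ⟨c.1, c.2.castSucc⟩

/-- The number `N_ν = 1 + ∑_j (1 + j) ρ_j`. -/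
def signatureDim {k : ℕ} (ρ : Fin k → ℕ) : ℕ := 1 + ∑ i : Fin k, (1 + ((i : ℕ) + 1)) * ρ i

/-- `N_ν` is the dimension of `J^ν`. -/
theorem finrank_jetSpace {k : ℕ} (ρ : Fin k → ℕ) :
    Module.finrank ℝ (JetSpace ρ) = signatureDim ρ := by
  simp only [JetSpace, signatureDim, Module.finrank_prod, Module.finrank_self,
    Module.finrank_fintype_fun_eq_card, Fintype.card_sigma, Fintype.sum_sigma]
  congr 1
  refine Finset.sum_congr rfl fun i _ => ?_
  have h : ∀ y ∈ (Finset.univ : Finset (Fin (ρ i))),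
      Fintype.card (Fin (SigIndex.order (ρ := ρ) ⟨i, y⟩ + 1)) = 1 + ((i : ℕ) + 1) :=
    fun y _ => (Fintype.card_fin _).trans (Nat.add_comm _ _)
  rw [Finset.sum_congr rfl h]
  simp [Nat.mul_comm]

/-- The contact form `dz^a_l - z^a_{l+1} dt`, `0 ≤ l < r_a`, at the point `z`. -/
def contactForm {k : ℕ} {ρ : Fin k → ℕ} (z : JetSpace ρ) (c : LowerJetIndex ρ) :
    JetSpace ρ →L[ℝ] ℝ :=
  (ContinuousLinearMap.proj (R := ℝ) (φ := fun _ : JetIndex ρ => ℝ) ⟨c.1, c.2.castSucc⟩).comp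
      (ContinuousLinearMap.snd ℝ ℝ (JetIndex ρ → ℝ))
    - z.2 ⟨c.1, c.2.succ⟩ • ContinuousLinearMap.fst ℝ ℝ (JetIndex ρ → ℝ)

/-- The contact system (Brunovsky normal form) `β^ν` on `J^ν`. -/
def contactSystem {k : ℕ} (ρ : Fin k → ℕ) : Codistribution (JetSpace ρ) :=
  fun z => Submodule.span ℝ (Set.range (contactForm z))

/-- The `ν`-jet `t ↦ (t, f^a(t), …, (f^a)^(r_a)(t))` of a tuple of functions `f`. -/
def jetCurve {k : ℕ} {ρ : Fin k → ℕ} (f : SigIndex ρ → ℝ → ℝ) (t : ℝ) : JetSpace ρ :=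
  (t, fun c => iteratedDeriv (c.2 : ℕ) (f c.1) t)

/-- The coordinate vector field of the highest order coordinate `z^a_{r_a}`. -/
def topVector {k : ℕ} {ρ : Fin k → ℕ} (a : SigIndex ρ) : JetSpace ρ :=
  (0, Pi.single ⟨a, Fin.last a.order⟩ 1)

/-! ### Explicit solutions -/

/-- Every trajectory whose jet at the instant `t₀` lies in `W` is, near `t₀`, of the form `ψ ∘ j^ν f`
for smooth functions `f` whose `ν`-jets lie in `D`. -/
def Describes {n m k : ℕ} {ρ : Fin k → ℕ} (S : ControlSystem n m) (D : Set (JetSpace ρ))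
    (ψ : JetSpace ρ → ControlSpace n m) {K : ℕ} (W : Set (TrajectoryJetSpace n m K)) : Prop :=
  ∀ (I : Set ℝ) (s : ℝ → ControlSpace n m), IsOpen I → S.IsTrajectoryOn s I →
    ∀ t₀ ∈ I, trajectoryJet K s t₀ ∈ W →
      ∃ (I' : Set ℝ) (f : SigIndex ρ → ℝ → ℝ), IsOpen I' ∧ t₀ ∈ I' ∧ I' ⊆ I ∧
        (∀ a, ContDiffOn ℝ ∞ (f a) I') ∧ MapsTo (jetCurve f) I' D ∧
        EqOn s (ψ ∘ jetCurve f) I'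

/-- `s = ψ ∘ j^ν f`, with `ψ` defined on the open set `D ⊆ J^ν`, is an explicit solution
of signature `ν` of the control system: there are as many arbitrary functions as inputs, the function
with index `a` occurs to order exactly `r_a`, every choice of the functions gives a trajectory, and
all generic trajectories are locally obtained in this way. Here "generic" means: the jet
`(t, x, u, u', …, u^(K))` of the trajectory, for some fixed `K`, lies in an open dense set. -/
structure IsExplicitSolution {n m k : ℕ} {ρ : Fin k → ℕ} (S : ControlSystem n m)
    (D : Set (JetSpace ρ)) (ψ : JetSpace ρ → ControlSpace n m) : Prop where
  card_eq : ∑ i, ρ i = m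
  isOpen_domain : IsOpen D
  nonempty_domain : D.Nonempty
  contDiffOn : ContDiffOn ℝ ∞ ψ D
  mapsTo : MapsTo ψ D S.carrier
  order_eq : ∀ a : SigIndex ρ, ∃ z ∈ D, fderiv ℝ ψ z (topVector a) ≠ 0
  isTrajectoryOn : ∀ (I : Set ℝ) (f : SigIndex ρ → ℝ → ℝ), IsOpen I →
    (∀ a, ContDiffOn ℝ ∞ (f a) I) → MapsTo (jetCurve f) I D →
    S.IsTrajectoryOn (ψ ∘ jetCurve f) I
  describes_generic : ∃ (K : ℕ) (G : Set (TrajectoryJetSpace n m K)), IsOpen G ∧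
    S.jetsOver K ⊆ closure G ∧ Describes S D ψ G

/-! ### Static feedback transformations -/

/-- On the open set `V`, `ψ` is a static feedback transformation from `J^ν` (the states being the
coordinates of non-maximal order, the inputs those of maximal order) onto its open image: a
diffeomorphism of the form `(t, x, u) ↦ (t, θ (t, x), χ (t, x, u))`. -/
structure IsStaticFeedbackOn {n m k : ℕ} {ρ : Fin k → ℕ} (ψ : JetSpace ρ → ControlSpace n m)
    (V : Set (JetSpace ρ)) : Prop where
  diffeo : ∃ e : OpenPartialHomeomorph (JetSpace ρ) (ControlSpace n m), e.source = V ∧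
    EqOn ψ e V ∧ ContDiffOn ℝ ∞ e e.source ∧ ContDiffOn ℝ ∞ e.symm e.target
  time_eq : ∀ z ∈ V, (ψ z).1 = z.1
  state_eq : ∃ θ : ℝ × (LowerJetIndex ρ → ℝ) → (Fin n → ℝ),
    ContDiffOn ℝ ∞ θ ((fun z : JetSpace ρ => (z.1, z.lower)) '' V) ∧
    ∀ z ∈ V, (ψ z).2.1 = θ (z.1, z.lower)

/-- The points of `D` at which `ψ` is a (smooth) local diffeomorphism. -/
def localDiffeoLocus {n m k : ℕ} {ρ : Fin k → ℕ} (ψ : JetSpace ρ → ControlSpace n m)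
    (D : Set (JetSpace ρ)) : Set (JetSpace ρ) :=
  {z ∈ D | IsLocalDiffeomorphAt 𝓘(ℝ, JetSpace ρ) 𝓘(ℝ, ControlSpace n m) ∞ ψ z}

end

/-! The map `ψ` is controlled by its first-order behaviour. Jet curves through a point, with
arbitrary next derivatives, are sent to trajectories; comparing velocities shows that `ω` pulls back
into the contact system at every point of `D` (`comp_fderiv_mem_contactSystem`). Where `Dψ` is
invertible the pullback is injective, so equal ranks turn this inclusion into an equality
(`pullback_eq_contactSystem`).

Invertibility somewhere is Sard's lemma. Every jet over `M` comes from a trajectory, so if `ψ` on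
`V` describes an open set of jets, freezing the derivatives of `u` yields a nonempty open set inside
`ψ '' V`. Since the dimensions agree, `Dψ` cannot be singular on all of `V`
(`inter_localDiffeoLocus_nonempty`). Taking `V = D ∩ ψ ⁻¹' O` for arbitrary open `O` meeting `M`
gives density of the image.

Over that dense open image, local inverses lift trajectories to integral curves of the contact
system, which are jet curves (`describes_localDiffeoLocus`). The feedback form holds because contact
forms kill the top directions: along these `t`, and hence `x`, is constant. -/

/-! ### Calculus -/

/-- Existence of smooth functions with a prescribed finite jet at a point. -/
theorem exists_contDiff_iteratedDeriv_eq (N : ℕ) (t₀ : ℝ) (c : ℕ → ℝ) :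
    ∃ q : ℝ → ℝ, ContDiff ℝ ∞ q ∧ ∀ l < N, iteratedDeriv l q t₀ = c l := by
  induction N generalizing c with
  | zero => exact ⟨0, contDiff_const, by simp⟩
  | succ N ih =>
    -- Realise the shifted values first; an antiderivative with constant `c 0` then has the required
    -- jet.
    obtain ⟨q, hq, h⟩ := ih fun l => c (l + 1)
    have hd : ∀ t, HasDerivAt (fun t => c 0 + ∫ τ in t₀..t, q τ) (q t) t := fun t =>
      (intervalIntegral.integral_hasDerivAt_right (hq.continuous.intervalIntegrable _ _)
        hq.continuous.stronglyMeasurable.stronglyMeasurableAtFilter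
        hq.continuous.continuousAt).const_add _
    have hd' : deriv (fun t => c 0 + ∫ τ in t₀..t, q τ) = q := funext fun t => (hd t).deriv
    refine ⟨fun t => c 0 + ∫ τ in t₀..t, q τ, ?_, fun l hl => ?_⟩
    · rw [contDiff_infty_iff_deriv, hd']
      exact ⟨fun t => (hd t).differentiableAt, hq⟩
    · cases l with
      | zero => simp
      | succ l => rw [iteratedDeriv_succ', hd', h l (by lia)]

/-- Integral curves of a smooth vector field are smooth. -/
theorem contDiffOn_infty_of_hasDerivAt {E : Type*} [NormedAddCommGroup E] [NormedSpace ℝ E]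
    {F : E → E} {Ω : Set E} {α : ℝ → E} {I : Set ℝ} (hF : ContDiffOn ℝ ∞ F Ω) (hI : IsOpen I)
    (hα : ∀ t ∈ I, HasDerivAt α (F (α t)) t) (hm : MapsTo α I Ω) : ContDiffOn ℝ ∞ α I := by
  rw [contDiffOn_infty]
  intro N
  induction N with
  | zero =>
    exact contDiffOn_zero.2 fun t ht => (hα t ht).continuousAt.continuousWithinAt
  | succ N ih =>
    rw [Nat.cast_add, Nat.cast_one, contDiffOn_succ_iff_deriv_of_isOpen hI]
    refine ⟨fun t ht => (hα t ht).differentiableAt.differentiableWithinAt, by simp, ?_⟩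
    exact ((hF.of_le (by exact_mod_cast le_top)).comp ih hm).congr fun t ht => (hα t ht).deriv

/-- Sard's lemma in equal dimensions: a differentiable map whose image has interior points has an
invertible derivative somewhere. -/
theorem exists_hasFDerivAt_equiv_of_subset_image {E F : Type*}
    [NormedAddCommGroup E] [NormedSpace ℝ E] [FiniteDimensional ℝ E]
    [NormedAddCommGroup F] [NormedSpace ℝ F] [FiniteDimensional ℝ F]
    (hd : Module.finrank ℝ F = Module.finrank ℝ E) {g : E → F} {V : Set E} {O : Set F}
    (hg : ∀ z ∈ V, DifferentiableAt ℝ g z) (hO : IsOpen O) (hne : O.Nonempty) (hsub : O ⊆ g '' V) :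
    ∃ z ∈ V, ∃ e : E ≃L[ℝ] F, HasFDerivAt g (e : E →L[ℝ] F) z := by
  by_contra! hcon
  -- Composing with `L` gives a self-map of `E`, for which determinants and Haar measure are
  -- available.
  let L : F ≃L[ℝ] E := ContinuousLinearEquiv.ofFinrankEq hd
  borelize E
  have h0 : MeasureTheory.Measure.addHaar ((L ∘ g) '' V) = 0 := by
    refine MeasureTheory.addHaar_image_eq_zero_of_det_fderivWithin_eq_zero _
      (f' := fun z => (L : F →L[ℝ] E).comp (fderiv ℝ g z)) (fun z hz => ?_) fun z hz => ?_
    · exact (L.hasFDerivAt.comp z (hg z hz).hasFDerivAt).hasFDerivWithinAt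
    · by_contra hdet
      let e := ((L : F →L[ℝ] E).comp (fderiv ℝ g z)).toContinuousLinearEquivOfDetNeZero hdet
      refine hcon z hz (e.trans L.symm) ?_
      convert! (hg z hz).hasFDerivAt using 1
      ext v
      simp [e]
  have hpos : 0 < MeasureTheory.Measure.addHaar (L '' O) :=
    (L.toHomeomorph.isOpenMap O hO).measure_pos _ (hne.image L)
  refine hpos.ne' (MeasureTheory.measure_mono_null ?_ h0)
  rw [image_comp]
  exact image_mono hsub

/-- For smooth maps on an open set, local diffeomorphisms are characterized by the derivative. -/
theorem isLocalDiffeomorphAt_iff_hasFDerivAt_equiv {E F : Type*}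
    [NormedAddCommGroup E] [NormedSpace ℝ E] [CompleteSpace E]
    [NormedAddCommGroup F] [NormedSpace ℝ F] {g : E → F} {D : Set E} (hD : IsOpen D)
    (hg : ContDiffOn ℝ ∞ g D) {z : E} (hz : z ∈ D) :
    IsLocalDiffeomorphAt 𝓘(ℝ, E) 𝓘(ℝ, F) ∞ g z ↔
      ∃ e : E ≃L[ℝ] F, HasFDerivAt g (e : E →L[ℝ] F) z := by
  have hgz : ∀ y ∈ D, ContDiffAt ℝ ∞ g y := fun y hy => hg.contDiffAt (hD.mem_nhds hy)
  refine ⟨fun h => ⟨h.mfderivToContinuousLinearEquiv (by simp), ?_⟩, fun ⟨e, he⟩ => ?_⟩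
  · have h1 := ((hgz z hz).differentiableAt (by simp)).hasFDerivAt
    rw [← mfderiv_eq_fderiv] at h1
    exact h1
  · let Φ := (hgz z hz).toOpenPartialHomeomorph g he (by simp)
    have hΦ : ∀ y, Φ y = g y := fun _ => rfl
    -- The inverse function theorem gives a homeomorphism; restricting its source to points with
    -- invertible derivative makes the inverse smooth on the whole target.
    let inv : Set E := {y | ∃ e : E ≃L[ℝ] F, (e : E →L[ℝ] F) = fderiv ℝ g y}
    have hopen : IsOpen (D ∩ inv) :=
      (hg.continuousOn_fderiv_of_isOpen hD (by simp)).isOpen_inter_preimage hD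
        ContinuousLinearEquiv.isOpen
    let Ψ := Φ.restrOpen _ hopen
    have hsrc : Ψ.source = Φ.source ∩ (D ∩ inv) := Φ.restrOpen_source _ hopen
    refine ⟨⟨Ψ.toPartialEquiv, Ψ.open_source, Ψ.open_target, ?_, ?_⟩, ?_, fun _ _ => rfl⟩
    · exact contMDiffOn_iff_contDiffOn.2 (hg.mono fun y hy => (hsrc.subset hy).2.1)
    · refine contMDiffOn_iff_contDiffOn.2 fun y hy => ContDiffAt.contDiffWithinAt ?_
      have hy' : Ψ.symm y ∈ Φ.source ∩ (D ∩ inv) := hsrc ▸ Ψ.map_target hy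
      obtain ⟨-, hyD, e', he'⟩ := hy'
      refine Ψ.contDiffAt_symm (f₀' := e') hy ?_ (hgz _ hyD)
      rw [he']
      exact ((hgz _ hyD).differentiableAt (by simp)).hasFDerivAt
    · change z ∈ Ψ.source
      rw [hsrc]
      exact ⟨(hgz z hz).mem_toOpenPartialHomeomorph_source he (by simp), hz, e, he.fderiv.symm⟩

/-! ### Trajectories -/

namespace ControlSystem

variable {n m : ℕ}

theorem isOpen_carrier (S : ControlSystem n m) : IsOpen S.carrier :=
  S.isOpen_time.prod (S.isOpen_states.prod S.isOpen_inputs)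

@[simp]
theorem form_apply (S : ControlSystem n m) (p v : ControlSpace n m) (i : Fin n) :
    S.form p i v = v.2.1 i - S.rhs p i * v.1 := rfl

theorem form_mem (S : ControlSystem n m) (p : ControlSpace n m) (i : Fin n) :
    S.form p i ∈ S.codistribution p :=
  Submodule.subset_span ⟨i, rfl⟩

/-- Every jet over `M` is the jet of a trajectory. -/
theorem exists_isTrajectoryOn_trajectoryJet_eq (S : ControlSystem n m) {K : ℕ}
    (p : TrajectoryJetSpace n m K) (hp : p ∈ S.jetsOver K) :
    ∃ (I : Set ℝ) (s : ℝ → ControlSpace n m), IsOpen I ∧ p.1.1 ∈ I ∧ S.IsTrajectoryOn s I ∧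
      trajectoryJet K s p.1.1 = p := by
  obtain ⟨⟨t₀, x₀, u₀⟩, p'⟩ := p
  have hq : ∀ a : Fin m, ∃ q : ℝ → ℝ, ContDiff ℝ ∞ q ∧ q t₀ = u₀ a ∧
      ∀ l : Fin K, iteratedDeriv ((l : ℕ) + 1) q t₀ = p' l a := by
    intro a
    -- Index `0` carries `u₀ a` and index `l + 1` carries `p' l a`; the guard `0 < l` is needed
    -- because `0 - 1 = 0` in `ℕ`.
    obtain ⟨q, hq, h⟩ := exists_contDiff_iteratedDeriv_eq (K + 1) t₀
      (fun l => if h : l - 1 < K ∧ 0 < l then p' ⟨l - 1, h.1⟩ a else u₀ a)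
    refine ⟨q, hq, by simpa using h 0 (by simp), fun l => ?_⟩
    rw [h _ (by simp)]
    simp
  choose q hqs hq0 hqK using hq
  let u : ℝ → Fin m → ℝ := fun t a => q a t
  have hu : ContDiff ℝ ∞ u := contDiff_pi.2 hqs
  have hu0 : u t₀ = u₀ := funext hq0
  let ι : ℝ × (Fin n → ℝ) → ControlSpace n m := fun y => (y.1, y.2, u y.1)
  have hι : ContDiff ℝ ∞ ι := by fun_prop
  -- With the input fixed as a function of time, adjoining time as a state makes the equation
  -- autonomous.
  let F : ℝ × (Fin n → ℝ) → ℝ × (Fin n → ℝ) := fun y => (1, S.rhs (ι y))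
  let Ω := ι ⁻¹' S.carrier
  have hΩ : IsOpen Ω := S.isOpen_carrier.preimage hι.continuous
  have hF : ContDiffOn ℝ ∞ F Ω :=
    contDiffOn_const.prodMk (S.contDiffOn_rhs.comp hι.contDiffOn fun _ h => h)
  have h0 : (t₀, x₀) ∈ Ω := by
    change (t₀, x₀, u t₀) ∈ S.carrier
    rw [hu0]
    exact hp
  obtain ⟨α, hα0, ε, hε, hα⟩ :=
    ((hF.contDiffAt (hΩ.mem_nhds h0)).of_le (by simp : (1 : WithTop ℕ∞) ≤ ∞)
      ).exists_forall_mem_closedBall_exists_eq_forall_mem_Ioo_hasDerivAt₀ t₀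
  have ht₀ : t₀ ∈ Ioo (t₀ - ε) (t₀ + ε) := by constructor <;> linarith
  have hI : IsOpen (Ioo (t₀ - ε) (t₀ + ε) ∩ α ⁻¹' Ω) :=
    ContinuousOn.isOpen_inter_preimage (fun t ht => (hα t ht).continuousAt.continuousWithinAt)
      isOpen_Ioo hΩ
  have htime : ∀ t ∈ Ioo (t₀ - ε) (t₀ + ε), (α t).1 = t := by
    intro t ht
    have hd : ∀ τ ∈ Ioo (t₀ - ε) (t₀ + ε), HasDerivAt (fun τ => (α τ).1 - τ) 0 τ := by
      intro τ hτ
      have h : HasDerivAt (fun τ => (α τ).1) 1 τ := (hα τ hτ).fst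
      simpa using h.fun_sub (hasDerivAt_id' τ)
    have := isOpen_Ioo.is_const_of_deriv_eq_zero isPreconnected_Ioo
      (fun τ hτ => (hd τ hτ).differentiableAt.differentiableWithinAt)
      (fun τ hτ => (hd τ hτ).deriv) ht ht₀
    simpa [hα0, sub_eq_zero] using this
  have hαs := contDiffOn_infty_of_hasDerivAt hF hI (fun t ht => hα t ht.1) fun t ht => ht.2
  refine ⟨_, fun t => ι (α t), hI, ⟨ht₀, by simpa [hα0] using h0⟩,
    ⟨hι.comp_contDiffOn hαs, fun t ht => ht.2, fun t ht => htime t ht.1, fun t ht ξ hξ => ?_⟩, ?_⟩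
  · have hder : HasDerivAt (fun t => ι (α t))
        ((1, S.rhs (ι (α t)), deriv (fun t => u (α t).1) t)) t := by
      have h1 := hα t ht.1
      have h2 : DifferentiableAt ℝ (fun t => u (α t).1) t :=
        (hu.differentiable (by simp) _).comp t h1.differentiableAt.fst
      exact h1.fst.prodMk (h1.snd.prodMk h2.hasDerivAt)
    rw [hder.deriv]
    induction hξ using Submodule.span_induction with
    | mem ξ h => obtain ⟨i, rfl⟩ := h; simp
    | zero => rfl
    | add ξ η _ _ h1 h2 => simp [h1, h2]
    | smul c ξ _ h => simp [h]
  · refine Prod.ext ?_ ?_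
    · change ι (α t₀) = _
      simp [hα0, ι, hu0]
    · funext l a
      change iteratedDeriv ((l : ℕ) + 1) (fun τ => q a (α τ).1) t₀ = p' l a
      rw [← hqK a l]
      exact Set.EqOn.iteratedDeriv_of_isOpen (fun τ hτ => by simp only [htime τ hτ])
        isOpen_Ioo _ ht₀

end ControlSystem

/-- If `ψ` on `V` describes an open set of jets over `M`, its image has interior points. -/
theorem Describes.exists_isOpen_subset_image {n m k K : ℕ} {ρ : Fin k → ℕ} {S : ControlSystem n m}
    {V : Set (JetSpace ρ)} {ψ : JetSpace ρ → ControlSpace n m} {W : Set (TrajectoryJetSpace n m K)}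
    (h : Describes S V ψ W) (hW : IsOpen W) (hne : (W ∩ S.jetsOver K).Nonempty) :
    ∃ O : Set (ControlSpace n m), IsOpen O ∧ O.Nonempty ∧ O ⊆ ψ '' V := by
  obtain ⟨⟨p, p'⟩, hp, hpM⟩ := hne
  -- Slice of `W` at the fixed input derivatives `p'`.
  refine ⟨{x | (x, p') ∈ W} ∩ S.carrier, (hW.preimage (by fun_prop)).inter S.isOpen_carrier,
    ⟨p, hp, hpM⟩, fun x hx => ?_⟩
  obtain ⟨I, s, hI, ht, hs, hj⟩ := S.exists_isTrajectoryOn_trajectoryJet_eq (x, p') hx.2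
  obtain ⟨I', f, -, ht', -, -, hV, heq⟩ := h I s hI hs _ ht (by rw [hj]; exact hx.1)
  exact ⟨_, hV ht', (heq ht').symm.trans (congrArg Prod.fst hj)⟩

/-! ### Jets and the contact system -/

section Contact

variable {k : ℕ} {ρ : Fin k → ℕ}

@[simp]
theorem contactForm_apply (z v : JetSpace ρ) (c : LowerJetIndex ρ) :
    contactForm z c v = v.2 ⟨c.1, c.2.castSucc⟩ - z.2 ⟨c.1, c.2.succ⟩ * v.1 := rfl

theorem contactForm_mem (z : JetSpace ρ) (c : LowerJetIndex ρ) :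
    contactForm z c ∈ contactSystem ρ z :=
  Submodule.subset_span ⟨c, rfl⟩

/-- The point of the jet space with given time, lower coordinates, and top coordinates. -/
def JetSpace.ofLowerTop (t : ℝ) (y : LowerJetIndex ρ → ℝ) (w : SigIndex ρ → ℝ) : JetSpace ρ :=
  (t, fun c => Fin.lastCases (motive := fun _ => ℝ) (w c.1) (fun l => y ⟨c.1, l⟩) c.2)

@[simp]
theorem JetSpace.ofLowerTop_fst (t : ℝ) (y : LowerJetIndex ρ → ℝ) (w : SigIndex ρ → ℝ) :
    (ofLowerTop t y w).1 = t := rfl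

@[simp]
theorem JetSpace.ofLowerTop_castSucc (t : ℝ) (y : LowerJetIndex ρ → ℝ) (w : SigIndex ρ → ℝ)
    (a : SigIndex ρ) (l : Fin a.order) : (ofLowerTop t y w).2 ⟨a, l.castSucc⟩ = y ⟨a, l⟩ := by
  simp [ofLowerTop]

@[simp]
theorem JetSpace.ofLowerTop_last (t : ℝ) (y : LowerJetIndex ρ → ℝ) (w : SigIndex ρ → ℝ)
    (a : SigIndex ρ) : (ofLowerTop t y w).2 ⟨a, Fin.last _⟩ = w a := by
  simp [ofLowerTop]

/-- Two points of the jet space agree if their times, lower coordinates and top coordinates do. -/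
theorem JetSpace.ext_lower_top {z z' : JetSpace ρ} (h1 : z.1 = z'.1)
    (h2 : ∀ (a : SigIndex ρ) (l : Fin a.order), z.2 ⟨a, l.castSucc⟩ = z'.2 ⟨a, l.castSucc⟩)
    (h3 : ∀ a : SigIndex ρ, z.2 ⟨a, Fin.last _⟩ = z'.2 ⟨a, Fin.last _⟩) : z = z' := by
  refine Prod.ext h1 (funext fun ⟨a, l⟩ => ?_)
  induction l using Fin.lastCases with
  | last => exact h3 a
  | cast l => exact h2 a l

/-- The tangent vectors at `z` of the jet curves through `z`. -/
def contactVector (z : JetSpace ρ) (w : SigIndex ρ → ℝ) : JetSpace ρ :=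
  JetSpace.ofLowerTop 1 (fun c => z.2 ⟨c.1, c.2.succ⟩) w

theorem topVector_eq_sub (z : JetSpace ρ) (a : SigIndex ρ) :
    topVector a = contactVector z (Pi.single a 1) - contactVector z 0 := by
  refine JetSpace.ext_lower_top (by simp [topVector, contactVector]) (fun b l => ?_) fun b => ?_
  · have : (⟨b, l.castSucc⟩ : JetIndex ρ) ≠ ⟨a, Fin.last _⟩ := by
      rintro h
      obtain ⟨rfl, h⟩ := Sigma.mk.inj_iff.1 h
      exact (Fin.castSucc_lt_last l).ne (eq_of_heq h)
    simp [topVector, contactVector, Pi.single_eq_of_ne this]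
  · by_cases hb : b = a
    · subst hb
      simp [topVector, contactVector]
    · have : (⟨b, Fin.last _⟩ : JetIndex ρ) ≠ ⟨a, Fin.last _⟩ :=
        fun h => hb (Sigma.mk.inj_iff.1 h).1
      simp [topVector, contactVector, Pi.single_eq_of_ne this, Pi.single_eq_of_ne hb]

theorem topVector_ne_zero (a : SigIndex ρ) : topVector a ≠ 0 := fun h => by
  simpa [topVector] using congrFun (congrArg Prod.snd h) ⟨a, Fin.last _⟩

/-- A covector that annihilates the tangent vectors of all jet curves belongs to the contact
system. -/
theorem mem_contactSystem_of_forall_contactVector {z : JetSpace ρ} {η : JetSpace ρ →L[ℝ] ℝ}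
    (h : ∀ w, η (contactVector z w) = 0) : η ∈ contactSystem ρ z := by
  have htop : ∀ a : SigIndex ρ, η (topVector a) = 0 := fun a => by
    rw [topVector_eq_sub z, map_sub, h, h, sub_zero]
  have hη : η = ∑ c : LowerJetIndex ρ,
      η (0, Pi.single ⟨c.1, c.2.castSucc⟩ 1) • contactForm z c := by
    refine ContinuousLinearMap.ext fun v => ?_
    -- Subtracting a multiple of a contact vector removes the time component without changing the
    -- value of `η`.
    have hv : η v = η (0, v.2 - v.1 • (contactVector z 0).2) := by
      have : v - v.1 • contactVector z 0 = (0, v.2 - v.1 • (contactVector z 0).2) :=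
        Prod.ext (by simp [contactVector]) rfl
      rw [← this, map_sub, map_smul, h, smul_zero, sub_zero]
    have hsum : ∀ u : JetIndex ρ → ℝ, η (0, u) = ∑ c, u c * η (0, Pi.single c 1) := by
      intro u
      have := (η.toLinearMap ∘ₗ LinearMap.inr ℝ ℝ (JetIndex ρ → ℝ)).pi_apply_eq_sum_univ u
      simpa [← Pi.single_apply, Pi.single_comm, funext_iff] using this
    rw [hv, hsum, sum_apply]
    refine (Fintype.sum_sigma (α := fun a : SigIndex ρ => Fin (a.order + 1)) _).trans
      (Eq.trans (Finset.sum_congr rfl fun a _ => ?_)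
        (Fintype.sum_sigma (α := fun a : SigIndex ρ => Fin a.order) _).symm)
    have hlast : η (0, Pi.single (⟨a, Fin.last a.order⟩ : JetIndex ρ) 1) = 0 := htop a
    rw [Fin.sum_univ_castSucc, hlast, mul_zero, add_zero]
    refine Finset.sum_congr rfl fun l _ => ?_
    simp [contactVector]
    ring
  rw [hη]
  exact Submodule.sum_mem _ fun c _ => Submodule.smul_mem _ _ (contactForm_mem z c)

/-- Contact forms annihilate the directions in which only top coordinates vary. -/
theorem apply_eq_zero_of_mem_contactSystem {z d : JetSpace ρ} {η : JetSpace ρ →L[ℝ] ℝ}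
    (hη : η ∈ contactSystem ρ z) (h1 : d.1 = 0)
    (h2 : ∀ (a : SigIndex ρ) (l : Fin a.order), d.2 ⟨a, l.castSucc⟩ = 0) : η d = 0 := by
  induction hη using Submodule.span_induction with
  | mem ξ h => obtain ⟨c, rfl⟩ := h; simp [h1, h2]
  | zero => rfl
  | add ξ η _ _ h1 h2 => simp [h1, h2]
  | smul c ξ _ h => simp [h]

theorem hasDerivAt_jetCurve {f : SigIndex ρ → ℝ → ℝ} (hf : ∀ a, ContDiff ℝ ∞ (f a)) (t : ℝ) :
    HasDerivAt (jetCurve f) (1, fun c => iteratedDeriv ((c.2 : ℕ) + 1) (f c.1) t) t := by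
  refine (hasDerivAt_id t).prodMk (hasDerivAt_pi.2 fun c => ?_)
  rw [iteratedDeriv_succ]
  exact ((hf c.1).differentiable_iteratedDeriv _ (by exact_mod_cast WithTop.coe_lt_top _)
    t).hasDerivAt

/-- Every contact vector is the tangent vector of a jet curve. -/
theorem exists_hasDerivAt_jetCurve (z : JetSpace ρ) (w : SigIndex ρ → ℝ) :
    ∃ f : SigIndex ρ → ℝ → ℝ, (∀ a, ContDiff ℝ ∞ (f a)) ∧ jetCurve f z.1 = z ∧
      HasDerivAt (jetCurve f) (contactVector z w) z.1 := by
  have hf : ∀ a : SigIndex ρ, ∃ q : ℝ → ℝ, ContDiff ℝ ∞ q ∧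
      (∀ l : Fin (a.order + 1), iteratedDeriv l q z.1 = z.2 ⟨a, l⟩) ∧
      iteratedDeriv (a.order + 1) q z.1 = w a := by
    intro a
    obtain ⟨q, hq, h⟩ := exists_contDiff_iteratedDeriv_eq (a.order + 2) z.1
      (fun l => if h : l < a.order + 1 then z.2 ⟨a, ⟨l, h⟩⟩ else w a)
    refine ⟨q, hq, fun l => ?_, ?_⟩
    · rw [h _ (by lia), dif_pos l.2]
    · rw [h _ (by lia)]
      simp
  choose f hf hz hw using hf
  refine ⟨f, hf, Prod.ext rfl (funext fun c => hz c.1 c.2), ?_⟩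
  convert! hasDerivAt_jetCurve hf z.1 using 1
  refine JetSpace.ext_lower_top rfl (fun a l => ?_) fun a => ?_
  · simpa [contactVector] using (hz a l.succ).symm
  · simpa [contactVector] using (hw a).symm

theorem continuous_jetCurve {f : SigIndex ρ → ℝ → ℝ} (hf : ∀ a, ContDiff ℝ ∞ (f a)) :
    Continuous (jetCurve f) :=
  continuous_iff_continuousAt.2 fun t => (hasDerivAt_jetCurve hf t).continuousAt

/-- An integral curve of the contact system, parametrized by time, is a jet curve. -/
theorem eqOn_jetCurve_of_contactForm {c : ℝ → JetSpace ρ} {I : Set ℝ} (hI : IsOpen I)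
    (hd : ∀ t ∈ I, DifferentiableAt ℝ c t) (ht : ∀ t ∈ I, (c t).1 = t)
    (hc : ∀ t ∈ I, ∀ j, contactForm (c t) j (deriv c t) = 0) :
    EqOn (jetCurve fun a t => (c t).2 ⟨a, 0⟩) c I := by
  have hone : ∀ t ∈ I, (deriv c t).1 = 1 := fun t h => by
    have h1 : HasDerivAt (fun τ => (c τ).1) (deriv c t).1 t := (hd t h).hasDerivAt.fst
    rw [← h1.deriv, Filter.EventuallyEq.deriv_eq (Filter.eventuallyEq_of_mem (hI.mem_nhds h) ht),
      deriv_id'']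
  have key : ∀ (a : SigIndex ρ) (l : ℕ) (hl : l < a.order + 1), ∀ t ∈ I,
      iteratedDeriv l (fun t => (c t).2 ⟨a, 0⟩) t = (c t).2 ⟨a, ⟨l, hl⟩⟩ := by
    intro a l
    induction l with
    | zero => intro _ t _; simp
    | succ l ih =>
      intro hl t h
      have h1 := hc t h ⟨a, ⟨l, by lia⟩⟩
      rw [contactForm_apply, hone t h, mul_one, sub_eq_zero] at h1
      have h2 : HasDerivAt (fun t => (c t).2 ⟨a, ⟨l, by lia⟩⟩)
          ((deriv c t).2 ⟨a, ⟨l, by lia⟩⟩) t := hasDerivAt_pi.1 (hd t h).hasDerivAt.snd _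
      rw [iteratedDeriv_succ, Filter.EventuallyEq.deriv_eq
        (Filter.eventuallyEq_of_mem (hI.mem_nhds h) (ih (by lia))), h2.deriv]
      exact h1
  exact fun t h => Prod.ext (ht t h).symm (funext fun j => key j.1 j.2 j.2.2 t h)

end Contact

/-! ### Explicit solutions and their derivatives -/

section Solutions

variable {n m k : ℕ} {ρ : Fin k → ℕ} {S : ControlSystem n m} {D : Set (JetSpace ρ)}
  {ψ : JetSpace ρ → ControlSpace n m}

theorem localDiffeoLocus_subset : localDiffeoLocus ψ D ⊆ D := fun _ h => h.1

theorem mem_localDiffeoLocus_iff (hD : IsOpen D) (hs : ContDiffOn ℝ ∞ ψ D) {z : JetSpace ρ} :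
    z ∈ localDiffeoLocus ψ D ↔
      z ∈ D ∧ ∃ e : JetSpace ρ ≃L[ℝ] ControlSpace n m, HasFDerivAt ψ (e : _ →L[ℝ] _) z :=
  and_congr_right fun hz => isLocalDiffeomorphAt_iff_hasFDerivAt_equiv hD hs hz

theorem isOpen_localDiffeoLocus (hD : IsOpen D) : IsOpen (localDiffeoLocus ψ D) := by
  refine isOpen_iff_mem_nhds.2 fun z ⟨hz, Φ, hzΦ, hΦ⟩ => ?_
  filter_upwards [hD.mem_nhds hz, Φ.open_source.mem_nhds hzΦ] with y hy hyΦ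
  exact ⟨hy, Φ, hyΦ, hΦ⟩

namespace IsExplicitSolution

variable (h : IsExplicitSolution S D ψ)

include h

theorem differentiableAt {z : JetSpace ρ} (hz : z ∈ D) : DifferentiableAt ℝ ψ z :=
  (h.contDiffOn.contDiffAt (h.isOpen_domain.mem_nhds hz)).differentiableAt (by simp)

/-- Supplies the test curves through `z`: the next derivatives `w` are free, so their velocities
exhaust the contact vectors at `z`. -/
theorem exists_isTrajectoryOn {z : JetSpace ρ} (hz : z ∈ D) (w : SigIndex ρ → ℝ) :
    ∃ (I : Set ℝ) (f : SigIndex ρ → ℝ → ℝ), z.1 ∈ I ∧ jetCurve f z.1 = z ∧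
      HasDerivAt (jetCurve f) (contactVector z w) z.1 ∧ S.IsTrajectoryOn (ψ ∘ jetCurve f) I := by
  obtain ⟨f, hf, hfz, hd⟩ := exists_hasDerivAt_jetCurve z w
  exact ⟨jetCurve f ⁻¹' D, f, by simpa [hfz] using hz, hfz, hd,
    h.isTrajectoryOn _ f (h.isOpen_domain.preimage (continuous_jetCurve hf))
      (fun a => (hf a).contDiffOn) fun _ ht => ht⟩

theorem time_eq {z : JetSpace ρ} (hz : z ∈ D) : (ψ z).1 = z.1 := by
  obtain ⟨I, f, hzI, hfz, -, hs⟩ := h.exists_isTrajectoryOn hz 0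
  simpa [hfz] using hs.time_eq _ hzI

theorem fderiv_fst {z : JetSpace ρ} (hz : z ∈ D) (v : JetSpace ρ) :
    (fderiv ℝ ψ z v).1 = v.1 := by
  have h1 : HasFDerivAt (fun y => (ψ y).1) _ z := (h.differentiableAt hz).hasFDerivAt.fst
  have h2 : HasFDerivAt (fun y => (ψ y).1) (ContinuousLinearMap.fst ℝ ℝ (JetIndex ρ → ℝ)) z :=
    hasFDerivAt_fst.congr_of_eventuallyEq
      (Filter.eventuallyEq_of_mem (h.isOpen_domain.mem_nhds hz) fun y hy => h.time_eq hy)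
  exact DFunLike.congr_fun (h1.unique h2) v

/-- By the chain rule `Dψ` maps each contact vector to the velocity of a trajectory, which `ξ`
annihilates. -/
theorem comp_fderiv_mem_contactSystem {z : JetSpace ρ} (hz : z ∈ D)
    {ξ : ControlSpace n m →L[ℝ] ℝ} (hξ : ξ ∈ S.codistribution (ψ z)) :
    ξ.comp (fderiv ℝ ψ z) ∈ contactSystem ρ z := by
  refine mem_contactSystem_of_forall_contactVector fun w => ?_
  obtain ⟨I, f, hzI, hfz, hd, hs⟩ := h.exists_isTrajectoryOn hz w
  have h1 := hs.annihilates _ hzI ξ (by simpa [hfz] using hξ)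
  have h2 : HasFDerivAt ψ (fderiv ℝ ψ z) (jetCurve f z.1) := by
    rw [hfz]
    exact (h.differentiableAt hz).hasFDerivAt
  rwa [(h2.comp_hasDerivAt _ hd).deriv] at h1

theorem pullback_eq_contactSystem
    (hrank : ∀ p ∈ S.carrier, ∀ z : JetSpace ρ,
      Module.finrank ℝ (S.codistribution p) = Module.finrank ℝ (contactSystem ρ z))
    {z : JetSpace ρ} (hz : z ∈ localDiffeoLocus ψ D) :
    Codistribution.pullback ψ S.codistribution z = contactSystem ρ z := by
  obtain ⟨hzD, e, he⟩ := (mem_localDiffeoLocus_iff h.isOpen_domain h.contDiffOn).1 hz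
  refine Submodule.eq_of_le_of_finrank_eq ?_ ?_
  · rintro _ ⟨ξ, hξ, rfl⟩
    exact h.comp_fderiv_mem_contactSystem hzD hξ
  · rw [← hrank _ (h.mapsTo hzD) z]
    -- Composition with the invertible `Dψ` is injective on covectors, so the pullback keeps the
    -- rank of `ω`.
    refine (Submodule.equivMapOfInjective _ (fun ξ η hξη => ?_) _).finrank_eq.symm
    refine ContinuousLinearMap.ext fun v => ?_
    have := DFunLike.congr_fun hξη (e.symm v)
    simpa [he.fderiv] using this

/-- The states do not depend on the top coordinates, to first order. -/
theorem fderiv_state_eq_zero {z : JetSpace ρ} (hz : z ∈ D) {d : JetSpace ρ} (h1 : d.1 = 0)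
    (h2 : ∀ (a : SigIndex ρ) (l : Fin a.order), d.2 ⟨a, l.castSucc⟩ = 0) :
    (fderiv ℝ ψ z d).2.1 = 0 := by
  funext i
  have := apply_eq_zero_of_mem_contactSystem
    (h.comp_fderiv_mem_contactSystem hz (S.form_mem (ψ z) i)) h1 h2
  simpa [h.fderiv_fst hz, h1] using this

/-- Trajectories lift through local diffeomorphisms. -/
theorem describes_localDiffeoLocus
    (hpull : ∀ z ∈ localDiffeoLocus ψ D,
      Codistribution.pullback ψ S.codistribution z = contactSystem ρ z) :
    Describes S (localDiffeoLocus ψ D) ψ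
      {p : TrajectoryJetSpace n m 0 | p.1 ∈ ψ '' localDiffeoLocus ψ D} := by
  rintro I s hI hs t₀ ht₀ ⟨z₀, ⟨hz₀, Φ, hzΦ, hΦ⟩, hst⟩
  change ψ z₀ = s t₀ at hst
  have hsymm : ContDiffOn ℝ ∞ Φ.symm Φ.target := contMDiffOn_iff_contDiffOn.1 Φ.contMDiffOn_invFun
  -- The source of `Φ` need not lie in `D`, so this has to be imposed on the lift.
  have hO : IsOpen (Φ.target ∩ Φ.symm ⁻¹' D) :=
    hsymm.continuousOn.isOpen_inter_preimage Φ.open_target h.isOpen_domain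
  have hI' := hs.contDiffOn.continuousOn.isOpen_inter_preimage hI hO
  set I' := I ∩ s ⁻¹' (Φ.target ∩ Φ.symm ⁻¹' D)
  have h0 : t₀ ∈ I' := by
    have h1 : s t₀ = Φ z₀ := hst.symm.trans (hΦ hzΦ)
    have h2 : Φ.symm (s t₀) = z₀ := by
      rw [h1]
      exact Φ.left_inv hzΦ
    refine ⟨ht₀, ?_, ?_⟩
    · rw [h1]
      exact Φ.map_source hzΦ
    · change Φ.symm (s t₀) ∈ D
      rwa [h2]
  let c : ℝ → JetSpace ρ := fun t => Φ.symm (s t)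
  have hc : ContDiffOn ℝ ∞ c I' :=
    hsymm.comp (hs.contDiffOn.mono inter_subset_left) fun t ht => ht.2.1
  have hcΦ : ∀ t ∈ I', c t ∈ Φ.source := fun t ht => Φ.map_target ht.2.1
  have hcl : ∀ t ∈ I', c t ∈ localDiffeoLocus ψ D := fun t ht => ⟨ht.2.2, Φ, hcΦ t ht, hΦ⟩
  have hψc : ∀ t ∈ I', s t = ψ (c t) := fun t ht =>
    (Φ.right_inv ht.2.1).symm.trans (hΦ (hcΦ t ht)).symm
  have hcd : ∀ t ∈ I', DifferentiableAt ℝ c t := fun t ht =>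
    (hc.contDiffAt (hI'.mem_nhds ht)).differentiableAt (by simp)
  have heq := eqOn_jetCurve_of_contactForm hI' hcd
    (fun t ht => by rw [← h.time_eq ht.2.2, ← hψc t ht, hs.time_eq t ht.1]) fun t ht j => by
      -- Each contact form is `ξ ∘ Dψ` with `ξ` in `ω`; on the velocity of the lift it equals `ξ` on
      -- the velocity of `s`, which is zero.
      have hmem := contactForm_mem (c t) j
      rw [← hpull _ (hcl t ht)] at hmem
      obtain ⟨ξ, hξ, hξe⟩ := hmem
      have h1 := hs.annihilates t ht.1 ξ (by rwa [hψc t ht])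
      rw [Filter.EventuallyEq.deriv_eq (Filter.eventuallyEq_of_mem (hI'.mem_nhds ht) hψc),
        show deriv (fun τ => ψ (c τ)) t = _ from
        ((h.differentiableAt ht.2.2).hasFDerivAt.comp_hasDerivAt t (hcd t ht).hasDerivAt).deriv]
        at h1
      rw [← hξe]
      exact h1
  refine ⟨I', fun a t => (c t).2 ⟨a, 0⟩, hI', h0, inter_subset_left, fun a => ?_,
    fun t ht => ?_, fun t ht => ?_⟩
  · exact contDiffOn_pi.1 hc.snd _
  · rw [heq ht]
    exact hcl t ht
  · rw [Function.comp_apply, heq ht]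
    exact hψc t ht

/-- Describing an open set of jets over `M` forces `ψ` to be a local diffeomorphism somewhere. -/
theorem inter_localDiffeoLocus_nonempty
    (hdim : Module.finrank ℝ (ControlSpace n m) = signatureDim ρ)
    {V : Set (JetSpace ρ)} {K : ℕ} {W : Set (TrajectoryJetSpace n m K)} (hVD : V ⊆ D)
    (hW : IsOpen W) (hne : (W ∩ S.jetsOver K).Nonempty) (hdes : Describes S V ψ W) :
    (V ∩ localDiffeoLocus ψ D).Nonempty := by
  obtain ⟨O, hO, hOne, hOV⟩ := hdes.exists_isOpen_subset_image hW hne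
  obtain ⟨z, hz, he⟩ := exists_hasFDerivAt_equiv_of_subset_image
    (hdim.trans (finrank_jetSpace ρ).symm) (fun z hz => h.differentiableAt (hVD hz)) hO hOne hOV
  exact ⟨z, hz, (mem_localDiffeoLocus_iff h.isOpen_domain h.contDiffOn).2 ⟨hVD hz, he⟩⟩

theorem carrier_subset_closure_image
    (hdim : Module.finrank ℝ (ControlSpace n m) = signatureDim ρ) :
    S.carrier ⊆ closure (ψ '' localDiffeoLocus ψ D) := by
  obtain ⟨K, G, hG, hGd, hdes⟩ := h.describes_generic
  intro p hp
  rw [mem_closure_iff]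
  intro O hO hpO
  have hfst : Continuous (Prod.fst : TrajectoryJetSpace n m K → ControlSpace n m) := continuous_fst
  have hOM := hO.inter S.isOpen_carrier
  obtain ⟨q, hqO, hqG⟩ := mem_closure_iff.1 (hGd (show (p, 0) ∈ S.jetsOver K from hp)) _
    (hOM.preimage hfst) ⟨hpO, hp⟩
  -- Localise to `O`: a trajectory with jet in `G` and base point in `O` stays in `O` for nearby
  -- times, so its jet curve stays in `ψ ⁻¹' O`.
  obtain ⟨z, hzV, hz⟩ := h.inter_localDiffeoLocus_nonempty hdim (V := D ∩ ψ ⁻¹' O)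
    (W := G ∩ Prod.fst ⁻¹' O) inter_subset_left (hG.inter (hO.preimage hfst))
    ⟨q, ⟨hqG, hqO.1⟩, hqO.2⟩ fun I s hI hs t₀ ht₀ hj => by
      obtain ⟨I', f, hI', h0, hsub, hf, hm, heq⟩ := hdes I s hI hs t₀ ht₀ hj.1
      have hop := (hs.contDiffOn.continuousOn.mono hsub).isOpen_inter_preimage hI' hO
      refine ⟨_, f, hop, ⟨h0, hj.2⟩, inter_subset_left.trans hsub,
        fun a => (hf a).mono inter_subset_left, fun t ht => ⟨hm ht.1, ?_⟩,
        heq.mono inter_subset_left⟩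
      have h1 : ψ (jetCurve f t) = s t := (heq ht.1).symm
      exact mem_preimage.2 (h1 ▸ ht.2)
  exact ⟨ψ z, hzV.2, mem_image_of_mem ψ hz⟩

theorem isOpen_image_localDiffeoLocus : IsOpen (ψ '' localDiffeoLocus ψ D) := by
  refine isOpen_iff_mem_nhds.2 ?_
  rintro _ ⟨z, hz, rfl⟩
  obtain ⟨hzD, e, he⟩ := (mem_localDiffeoLocus_iff h.isOpen_domain h.contDiffOn).1 hz
  have hst := (h.contDiffOn.contDiffAt (h.isOpen_domain.mem_nhds hzD)).hasStrictFDerivAt' he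
    (by simp)
  rw [← hst.map_nhds_eq_of_equiv]
  exact Filter.image_mem_map ((isOpen_localDiffeoLocus h.isOpen_domain).mem_nhds hz)

theorem isExplicitSolution_localDiffeoLocus
    (hdim : Module.finrank ℝ (ControlSpace n m) = signatureDim ρ)
    (hpull : ∀ z ∈ localDiffeoLocus ψ D,
      Codistribution.pullback ψ S.codistribution z = contactSystem ρ z) :
    IsExplicitSolution S (localDiffeoLocus ψ D) ψ := by
  have hcl := h.carrier_subset_closure_image hdim
  have hne : (localDiffeoLocus ψ D).Nonempty := by
    obtain ⟨z, hz⟩ := h.nonempty_domain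
    exact (closure_nonempty_iff.1 ⟨_, hcl (h.mapsTo hz)⟩).of_image
  have hfst : IsOpenMap (Prod.fst : TrajectoryJetSpace n m 0 → ControlSpace n m) := isOpenMap_fst
  exact
    { card_eq := h.card_eq
      isOpen_domain := isOpen_localDiffeoLocus h.isOpen_domain
      nonempty_domain := hne
      contDiffOn := h.contDiffOn.mono localDiffeoLocus_subset
      mapsTo := h.mapsTo.mono_left localDiffeoLocus_subset
      order_eq := fun a => by
        obtain ⟨z, hz⟩ := hne
        obtain ⟨-, e, he⟩ := (mem_localDiffeoLocus_iff h.isOpen_domain h.contDiffOn).1 hz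
        refine ⟨z, hz, ?_⟩
        rw [he.fderiv]
        exact e.map_ne_zero_iff.2 (topVector_ne_zero a)
      isTrajectoryOn := fun I f hI hf hm =>
        h.isTrajectoryOn I f hI hf (hm.mono_right localDiffeoLocus_subset)
      -- Lifting depends only on the point of `M`, so `K = 0` suffices.
      describes_generic := ⟨0, {p | p.1 ∈ ψ '' localDiffeoLocus ψ D},
        h.isOpen_image_localDiffeoLocus.preimage continuous_fst,
        fun p hp => hfst.preimage_closure_subset_closure_preimage (hcl hp),
        h.describes_localDiffeoLocus hpull⟩ }

/-- On small balls, an explicit solution that is a local diffeomorphism is a static feedback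
transformation. -/
theorem exists_isStaticFeedbackOn {z₀ : JetSpace ρ} (hz₀ : z₀ ∈ localDiffeoLocus ψ D) :
    ∃ V : Set (JetSpace ρ), IsOpen V ∧ z₀ ∈ V ∧ V ⊆ localDiffeoLocus ψ D ∧
      IsStaticFeedbackOn ψ V := by
  obtain ⟨hzD, Φ, hzΦ, hΦ⟩ := hz₀
  obtain ⟨ε, hε, hball⟩ := Metric.isOpen_iff.1 (h.isOpen_domain.inter Φ.open_source) z₀ ⟨hzD, hzΦ⟩
  have hbD : Metric.ball z₀ ε ⊆ D := fun z hz => (hball hz).1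
  have hbΦ : Metric.ball z₀ ε ⊆ Φ.source := fun z hz => (hball hz).2
  -- Freeze the top coordinates at those of the centre; in the sup metric this keeps points of the
  -- ball inside it.
  let σ : ℝ × (LowerJetIndex ρ → ℝ) → JetSpace ρ := fun y =>
    JetSpace.ofLowerTop y.1 y.2 fun a => z₀.2 ⟨a, Fin.last _⟩
  have hσ : ContDiff ℝ ∞ σ := by
    refine contDiff_fst.prodMk (contDiff_pi.2 fun ⟨a, l⟩ => ?_)
    induction l using Fin.lastCases with
    | last => simpa using contDiff_const
    | cast l => simpa using contDiff_pi.1 contDiff_snd _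
  have hσb : ∀ z ∈ Metric.ball z₀ ε, σ (z.1, z.lower) ∈ Metric.ball z₀ ε := by
    intro z hz
    rw [Metric.mem_ball, Prod.dist_eq, max_lt_iff, dist_pi_lt_iff hε] at hz ⊢
    refine ⟨hz.1, fun ⟨a, l⟩ => ?_⟩
    induction l using Fin.lastCases with
    | last => simpa [σ] using hε
    | cast l => simpa [σ, JetSpace.lower] using hz.2 ⟨a, l.castSucc⟩
  let e := Φ.toOpenPartialHomeomorph.restrOpen _ (Metric.isOpen_ball (x := z₀) (ε := ε))
  have hes : e.source = Metric.ball z₀ ε := inter_eq_right.2 hbΦ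
  refine ⟨Metric.ball z₀ ε, Metric.isOpen_ball, Metric.mem_ball_self hε,
    fun z hz => ⟨hbD hz, Φ, hbΦ hz, hΦ⟩, ⟨e, hes, fun z hz => hΦ (hbΦ hz), ?_, ?_⟩,
    fun z hz => h.time_eq (hbD hz), fun y => (ψ (σ y)).2.1, ?_, fun z hz => ?_⟩
  · exact (contMDiffOn_iff_contDiffOn.1 Φ.contMDiffOn_toFun).mono fun z hz => hz.1
  · exact (contMDiffOn_iff_contDiffOn.1 Φ.contMDiffOn_invFun).mono fun z hz => hz.1
  · refine ((h.contDiffOn.comp hσ.contDiffOn ?_).snd).fst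
    rintro _ ⟨z, hz, rfl⟩
    exact hbD (hσb z hz)
  · set z' := σ (z.1, z.lower) with hz'
    have hd1 : (z - z').1 = 0 := sub_self _
    have hd2 : ∀ (a : SigIndex ρ) (l : Fin a.order), (z - z').2 ⟨a, l.castSucc⟩ = 0 := by
      intro a l
      simp [hz', σ, JetSpace.lower]
    -- The segment from `z'` to `z` lies in the convex ball and runs in top directions only, so the
    -- state is constant along it.
    have hder : ∀ τ ∈ Icc (0 : ℝ) 1,
        HasDerivAt (fun τ => (ψ (AffineMap.lineMap z' z τ)).2.1) 0 τ := by
      intro τ hτ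
      have hmem := hbD ((convex_ball z₀ ε).lineMap_mem (hσb z hz) hz hτ)
      have h1 := (h.differentiableAt hmem).hasFDerivAt.comp_hasDerivAt τ
        (AffineMap.hasDerivAt_lineMap (a := z') (b := z) (x := τ))
      have h2 : HasDerivAt (fun τ => (ψ (AffineMap.lineMap z' z τ)).2.1) _ τ := h1.snd.fst
      rwa [← h.fderiv_state_eq_zero hmem hd1 hd2]
    simpa using constant_of_has_deriv_right_zero
      (fun τ hτ => (hder τ hτ).continuousAt.continuousWithinAt)
      (fun τ hτ => (hder τ (Ico_subset_Icc_self hτ)).hasDerivWithinAt) 1 (by simp)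

end IsExplicitSolution

end Solutions

theorem mainTheorem6 {n m k : ℕ} (ρ : Fin k → ℕ) (S : ControlSystem n m)
    (D : Set (JetSpace ρ)) (ψ : JetSpace ρ → ControlSpace n m)
    (hψ : IsExplicitSolution S D ψ)
    (hdim : Module.finrank ℝ (ControlSpace n m) = signatureDim ρ)
    (hrank : ∀ p ∈ S.carrier, ∀ z : JetSpace ρ,
      Module.finrank ℝ (S.codistribution p) = Module.finrank ℝ (contactSystem ρ z)) :
    IsExplicitSolution S (localDiffeoLocus ψ D) ψ ∧
    S.carrier ⊆ closure (ψ '' localDiffeoLocus ψ D) ∧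
    (∀ (V : Set (JetSpace ρ)) (K : ℕ) (W : Set (TrajectoryJetSpace n m K)),
      IsOpen V → V ⊆ D → IsOpen W → (W ∩ S.jetsOver K).Nonempty → Describes S V ψ W →
        (V ∩ localDiffeoLocus ψ D).Nonempty) ∧
    (∀ z ∈ localDiffeoLocus ψ D,
      Codistribution.pullback ψ S.codistribution z = contactSystem ρ z) ∧
    (∀ z ∈ localDiffeoLocus ψ D, ∃ V : Set (JetSpace ρ), IsOpen V ∧ z ∈ V ∧
      V ⊆ localDiffeoLocus ψ D ∧ IsStaticFeedbackOn ψ V) := by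
  have hpull := fun z (hz : z ∈ localDiffeoLocus ψ D) => hψ.pullback_eq_contactSystem hrank hz
  exact ⟨hψ.isExplicitSolution_localDiffeoLocus hdim hpull, hψ.carrier_subset_closure_image hdim,
    fun V K W _ hVD hW hne hdes => hψ.inter_localDiffeoLocus_nonempty hdim hVD hW hne hdes,
    hpull, fun z hz => hψ.exists_isStaticFeedbackOn hz⟩
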